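/- **Theorem 4.1.** *Setting.* Let $\nu,d$ be natural numbers, and let $\mathcal S$ be the Schwartz space of real valued functions on $\mathbb R^\nu$ with its usual topology. For $\varphi\in\mathcal S$ let $\tilde\varphi(x)=\int_{\mathbb R^\nu}e^{i(x,t)}\varphi(t)\,dt$. A *complex measure with locally finite total variation* on $\mathbb R^\nu$ is a complex valued function on the bounded Borel sets whose restriction to the measurable subsets of $[-T,T]^\nu$ is a complex measure with finite total variation for every $T>0$; it is *even* if $G(-A)=\overline{G(A)}$ for all bounded Borel sets $A$. Its total variation $|G|$ is a positive measure on the Borel sets of $\mathbb R^\nu$, possibly infinite. For $f$ with $\int|f|\,d|G|<\infty$ we set $\int f\,dG=\lim_{n\to\infty}\int_{[-n,n]^\nu}f\,dG$. Let $G=(G_{j,j'})_{1\le j,j'\le d}$ be a matrix of complex measures with locally finite total variation on $\mathbb R^\nu$. We call $G$ a *matrix valued spectral measure* if 1. $(G_{j,j'}(A))_{j,j'}$ is a Hermitian matrix for every bounded Borel set $A$, and $G$ is positive semidefinite: there is a $\sigma$-finite measure $\mu$ on $\mathbb R^\nu$ such that all $G_{j,j'}$ are absolutely continuous with respect to $\mu$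 on every cube $[-T,T]^\nu$, with Radon–Nikodym derivatives $g_{j,j'}$, and the matrix $(g_{j,j'}(x))_{j,j'}$ is positive semidefinite for $\mu$-almost all $x$; 2. every $G_{j,j'}$ is even; 3. $G$ is moderately increasing at infinity: for some $r>0$, $\int(1+|x|)^{-r}\,G_{j,j}(dx)<\infty$ for all $j$. A *$d$-dimensional generalized random field* is a family of $\mathbb R^d$-valued random vectors $X(\varphi)=(X_1(\varphi),\dots,X_d(\varphi))$, $\varphi\in\mathcal S$, on one probability space such that * for all $j$, all $a_1,a_2\in\mathbb R$ and all $\varphi,\psi\in\mathcal S$, $X_j(a_1\varphi+a_2\psi)=a_1X_j(\varphi)+a_2X_j(\psi)$ with probability 1; * $X_j(\varphi_n)\to X_j(\varphi)$ in probability for all $j$ whenever $\varphi_n\to\varphi$ in $\mathcal S$. It is *Gaussian* if for all $\varphi_1,\dots,\varphi_N\in\mathcal S$ the variables $X_j(\varphi_k)$, $1\le j\le d$, $1\le k\le N$, are jointly Gaussian. It is *stationary* if for each $t\in\mathbb R^\nu$ the fields $(X(\varphi))_{\varphi\in\mathcal S}$ and $(X(\varphi(\cdot-t)))_{\varphi\in\mathcal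 S}$ have the same distribution. The distribution of a field is its law on $(\mathbb R^d)^{\mathcal S}$ with the product $\sigma$-algebra; equivalently, it is the collection of all its joint finite dimensional distributions. *Statement.* Let $G$ be a matrix valued spectral measure. (i) There exists a $d$-dimensional Gaussian stationary generalized random field $X$ over $\mathcal S$ with $EX_j(\varphi)=0$ for all $j$ and all $\varphi\in\mathcal S$, and $$EX_j(\varphi)X_{j'}(\psi)=\int\tilde\varphi(x)\,\overline{\tilde\psi(x)}\,G_{j,j'}(dx)\qquad\text{for all }\varphi,\psi\in\mathcal S,\ 1\le j,j'\le d,\tag{4.2}$$ where all these integrals are absolutely convergent. (ii) Any two $d$-dimensional Gaussian stationary generalized random fields (on possibly different probability spaces) with zero expectation that satisfy (4.2) with this $G$ have the same distribution. (iii) For all $1\le j,j'\le d$ the covariance function determines $G_{j,j'}$: if $G'$ is another $d\times d$ matrix valued spectral measure, $r$ is a real valued function on $\mathcal S\times\mathcal S$, and $$r(\varphi,\psi)=\int\tilde\varphi\,\overline{\tilde\psi}\,dG_{j,j'}=\int\tilde\varphi\,\overline{\tilde\psi}\,dG'_{j,j'}\qquad\text{for all }\varphi,\psi\in\mathcal S,$$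 then $G_{j,j'}=G'_{j,j'}$. -/

import Mathlib

open MeasureTheory ProbabilityTheory Filter Topology
open scoped SchwartzMap ComplexConjugate ComplexOrder

noncomputable section

namespace GenField

/-- The space `ℝ^ν` with its Euclidean norm. -/
abbrev Space (ν : ℕ) : Type := EuclideanSpace ℝ (Fin ν)

/-- The bounded Borel subsets of `ℝ^ν`. -/
@[ext]
structure BoundedBorel (ν : ℕ) where
  /-- the underlying set -/
  carrier : Set (Space ν)
  measurableSet : MeasurableSet carrier
  isBounded : Bornology.IsBounded carrier

/-- The reflected set `-A`. -/
def BoundedBorel.neg {ν : ℕ} (A : BoundedBorel ν) : BoundedBorel ν where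
  carrier := {x | -x ∈ A.carrier}
  measurableSet := measurable_neg A.measurableSet
  isBounded := by
    have h : {x | -x ∈ A.carrier} = -A.carrier := rfl
    rw [h]
    exact A.isBounded.neg

/-- The cube `[-T, T]^ν`. -/
def cube (ν : ℕ) (T : ℝ) : Set (Space ν) := {x | ∀ i, x i ∈ Set.Icc (-T) T}

theorem measurableSet_cube (ν : ℕ) (T : ℝ) : MeasurableSet (cube ν T) := by
  have h : cube ν T = ⋂ i, (fun x : Space ν => x i) ⁻¹' Set.Icc (-T) T := by
    ext x
    simp only [cube, Set.mem_ofPred_eq, Set.mem_iInter, Set.mem_preimage]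
  rw [h]
  refine MeasurableSet.iInter fun i => ?_
  have hm : Measurable fun x : Space ν => x i := by fun_prop
  exact hm measurableSet_Icc

theorem isBounded_cube (ν : ℕ) (T : ℝ) : Bornology.IsBounded (cube ν T) := by
  refine isBounded_iff_forall_norm_le.2 ⟨∑ _i : Fin ν, |T|, fun x hx => ?_⟩
  have h1 : ‖x‖ ≤ ∑ i, ‖x i‖ := by
    rw [EuclideanSpace.norm_eq]
    refine Real.sqrt_le_iff.2 ⟨Finset.sum_nonneg fun i _ => norm_nonneg _, ?_⟩
    exact Finset.sum_sq_le_sq_sum_of_nonneg fun i _ => norm_nonneg _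
  refine h1.trans (Finset.sum_le_sum fun i _ => ?_)
  rw [Real.norm_eq_abs]
  exact (abs_le.2 ⟨(hx i).1, (hx i).2⟩).trans (le_abs_self T)

/-- A complex measure on `ℝ^ν` with locally finite total variation: a complex valued function
of the bounded Borel sets whose restriction to the measurable subsets of any cube `[-T, T]^ν`
is a complex measure of finite total variation. -/
@[ext]
structure LocComplexMeasure (ν : ℕ) where
  /-- the value on a bounded Borel set -/
  toFun : BoundedBorel ν → ℂ
  exists_restrict : ∀ T : ℝ, 0 < T → ∃ κ : ComplexMeasure (Space ν),
    IsFiniteMeasure κ.variation ∧ ∀ A : BoundedBorel ν, A.carrier ⊆ cube ν T → toFun A = κ A.carrier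

instance (ν : ℕ) : CoeFun (LocComplexMeasure ν) fun _ => BoundedBorel ν → ℂ :=
  ⟨LocComplexMeasure.toFun⟩

namespace LocComplexMeasure

variable {ν : ℕ}

/-- The set `A ∩ [-T, T]^ν` for a Borel set `A`. -/
def _root_.GenField.BoundedBorel.interCube (A : Set (Space ν)) (hA : MeasurableSet A) (T : ℝ) :
    BoundedBorel ν :=
  ⟨A ∩ cube ν T, hA.inter (measurableSet_cube ν T),
    (isBounded_cube ν T).subset Set.inter_subset_right⟩

theorem exists_interCube (G : LocComplexMeasure ν) (T : ℝ) :
    ∃ κ : ComplexMeasure (Space ν), ∀ (A : Set (Space ν)) (hA : MeasurableSet A),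
      G (BoundedBorel.interCube A hA T) = κ (A ∩ cube ν T) := by
  obtain ⟨κ, -, hκ⟩ := G.exists_restrict (max T 1) (by positivity)
  refine ⟨κ, fun A hA => hκ _ (Set.inter_subset_right.trans fun x hx i => ?_)⟩
  exact ⟨(neg_le_neg (le_max_left T 1)).trans (hx i).1, (hx i).2.trans (le_max_left T 1)⟩

open Classical in
/-- The restriction of `G` to the cube `[-T, T]^ν`, as the complex measure
`A ↦ G (A ∩ [-T, T]^ν)` on `ℝ^ν`. -/
def onCube (G : LocComplexMeasure ν) (T : ℝ) : ComplexMeasure (Space ν) where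
  measureOf' A := if h : MeasurableSet A then G (BoundedBorel.interCube A h T) else 0
  empty' := by
    obtain ⟨κ, hκ⟩ := G.exists_interCube T
    rw [dif_pos MeasurableSet.empty, hκ, Set.empty_inter, κ.empty]
  not_measurable' A hA := dif_neg hA
  m_iUnion' A hA hd := by
    obtain ⟨κ, hκ⟩ := G.exists_interCube T
    rw [dif_pos (MeasurableSet.iUnion hA), hκ, Set.iUnion_inter]
    have h : (fun i => if h : MeasurableSet (A i) then
        G (BoundedBorel.interCube (A i) h T) else 0) = fun i => κ (A i ∩ cube ν T) :=
      funext fun i => by rw [dif_pos (hA i), hκ]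
    rw [h]
    exact κ.m_iUnion (fun i => (hA i).inter (measurableSet_cube ν T))
      fun i j hij => (hd hij).mono Set.inter_subset_left Set.inter_subset_left

theorem onCube_apply (G : LocComplexMeasure ν) (T : ℝ) (A : Set (Space ν))
    (hA : MeasurableSet A) : G.onCube T A = G (BoundedBorel.interCube A hA T) :=
  dif_pos hA

/-- The total variation of `G`, a positive measure on all Borel sets of `ℝ^ν` (possibly
infinite): the increasing limit of the total variations of `G` on the cubes `[-n, n]^ν`.
If `G` takes nonnegative real values only, this is the extension of `G` to a positive measure
on all Borel sets. -/
def variation (G : LocComplexMeasure ν) : Measure (Space ν) :=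
  ⨆ n : ℕ, (G.onCube n).variation

/-- `G.HasIntegral f z` means that `f` is absolutely integrable with respect to `G`, over the
whole space, and `∫ f(x) G(dx) = z`. -/
def HasIntegral (G : LocComplexMeasure ν) (f : Space ν → ℂ) (z : ℂ) : Prop :=
  Integrable f G.variation ∧
    Tendsto (fun n : ℕ => (G.onCube n).integral f (ContinuousLinearMap.mul ℝ ℂ)) atTop (𝓝 z)

/-- Evenness: `G(-A)` is the complex conjugate of `G(A)`. -/
def IsEven (G : LocComplexMeasure ν) : Prop :=
  ∀ A : BoundedBorel ν, G A.neg = conj (G A)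

/-- `g` is the Radon-Nikodym derivative `dG/dμ`; in particular `G` is absolutely continuous
with respect to `μ` on every cube. -/
def IsDensity (G : LocComplexMeasure ν) (μ : Measure (Space ν)) (g : Space ν → ℂ) : Prop :=
  ∀ A : BoundedBorel ν, IntegrableOn g A.carrier μ ∧ G A = ∫ x in A.carrier, g x ∂μ

end LocComplexMeasure

variable {ν d : ℕ}

/-- The matrices `(G j j' A)` are Hermitian, and there is a σ-finite measure `μ` such that the
matrix of Radon-Nikodym derivatives `dG j j'/dμ` is positive semidefinite `μ`-almost everywhere. -/
def IsPosSemidefMatrixMeasure (G : Fin d → Fin d → LocComplexMeasure ν) : Prop :=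
  (∀ A : BoundedBorel ν, (Matrix.of fun j j' => G j j' A).IsHermitian) ∧
  ∃ μ : Measure (Space ν), SigmaFinite μ ∧
    ∃ g : Space ν → Matrix (Fin d) (Fin d) ℂ,
      (∀ j j', (G j j').IsDensity μ fun x => g x j j') ∧ ∀ᵐ x ∂μ, (g x).PosSemidef

/-- `∫ (1 + |x|)^(-r) G j j (dx) < ∞` for all `j`, with some `r > 0`. -/
def IsModeratelyIncreasing (G : Fin d → Fin d → LocComplexMeasure ν) : Prop :=
  ∃ r : ℝ, 0 < r ∧ ∀ j,
    ∫⁻ x, ENNReal.ofReal ((1 + ‖x‖) ^ (-r)) ∂(G j j).variation < ⊤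

/-- Positive semidefinite matrix valued, even measures on `ℝ^ν` whose distribution is moderately
increasing at infinity. -/
structure IsMatrixSpectralMeasure (G : Fin d → Fin d → LocComplexMeasure ν) : Prop where
  posSemidef : IsPosSemidefMatrixMeasure G
  even : ∀ j j', (G j j').IsEven
  moderate : IsModeratelyIncreasing G

/-- The Fourier transform `φ~(x) = ∫ exp(i(x,t)) φ(t) dt` of a real Schwartz function. -/
def schwartzFourier (φ : 𝓢(Space ν, ℝ)) (x : Space ν) : ℂ :=
  ∫ t : Space ν, Complex.exp (Complex.I * ((inner ℝ x t : ℝ) : ℂ)) * ((φ t : ℝ) : ℂ)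

section Fields

variable {Ω : Type*} [MeasurableSpace Ω]

/-- `d`-dimensional generalized random fields over the Schwartz space of real functions. -/
structure IsGeneralizedRandomField (P : Measure Ω)
    (X : 𝓢(Space ν, ℝ) → Ω → (Fin d → ℝ)) : Prop where
  measurable : ∀ φ, Measurable (X φ)
  linear : ∀ (a₁ a₂ : ℝ) (φ ψ : 𝓢(Space ν, ℝ)) (j : Fin d),
    ∀ᵐ ω ∂P, X (a₁ • φ + a₂ • ψ) ω j = a₁ * X φ ω j + a₂ * X ψ ω j
  continuous : ∀ (φs : ℕ → 𝓢(Space ν, ℝ)) (φ : 𝓢(Space ν, ℝ)),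
    Tendsto φs atTop (𝓝 φ) → ∀ j : Fin d,
      TendstoInMeasure P (fun n ω => X (φs n) ω j) atTop fun ω => X φ ω j

/-- Stationarity: the shifted field `φ ↦ X (T_t φ)`, where `T_t φ (x) = φ (x - t)`, has the same
distribution (all joint finite dimensional distributions included) as the field `X`. -/
def IsStationary (P : Measure Ω) (X : 𝓢(Space ν, ℝ) → Ω → (Fin d → ℝ)) : Prop :=
  ∀ t : Space ν, IdentDistrib (fun ω φ => X φ ω)
    (fun ω φ => X (SchwartzMap.compSubConstCLM ℝ t φ) ω) P P

/-- Gaussian stationary generalized random fields with zero expectation. `IsGaussianProcess`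
says that all `X φ₁, …, X φ_N` are jointly Gaussian random vectors. -/
structure IsCenteredGaussianStationaryField (P : Measure Ω)
    (X : 𝓢(Space ν, ℝ) → Ω → (Fin d → ℝ)) : Prop where
  field : IsGeneralizedRandomField P X
  gaussian : IsGaussianProcess X P
  stationary : IsStationary P X
  centered : ∀ φ j, ∫ ω, X φ ω j ∂P = 0

/-- The covariance function `E (X_j(φ) X_j'(ψ))`. -/
def covFun (P : Measure Ω) (X : 𝓢(Space ν, ℝ) → Ω → (Fin d → ℝ)) (j j' : Fin d)
    (φ ψ : 𝓢(Space ν, ℝ)) : ℝ :=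
  ∫ ω, X φ ω j * X ψ ω j' ∂P

end Fields

/-- `r(φ, ψ) = ∫ φ~(x) conj(ψ~(x)) G(dx)` for all real Schwartz functions `φ`, `ψ`, where the
integrals converge absolutely. -/
def HasSpectralRepresentation (G : LocComplexMeasure ν)
    (r : 𝓢(Space ν, ℝ) → 𝓢(Space ν, ℝ) → ℝ) : Prop :=
  ∀ φ ψ : 𝓢(Space ν, ℝ),
    G.HasIntegral (fun x => schwartzFourier φ x * conj (schwartzFourier ψ x)) ((r φ ψ : ℝ) : ℂ)

end GenField

end

open GenField

/-! Write G_{j,j'} = g_{j,j'} dμ with g positive semidefinite. Then |G_{j,j'}| = ‖g_{j,j'}‖ dμ, and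
`IsDensity.hasIntegral` turns every spectral integral into a Bochner integral against μ. Positivity
bounds each entry of g by diagonal ones (`Matrix.PosSemidef.norm_apply_le`), so moderate growth on
the diagonal makes all these integrals converge.

Existence of the field: on vectors of test functions, take the sum over j, j' of ∫ v_j~ conj(w_j'~)
dG_{j,j'}. Its terms are real by evenness, and it is symmetric and nonnegative because g is
Hermitian and positive semidefinite. It is therefore pulled back from the inner product of a Hilbert
space, and the isonormal Gaussian process over that space (`exists_isonormal`) is the desired field.
Continuity follows because the variance of X_j(φ) is at most the squared L²(|G_{j,j}|) norm of φ~
(`re_spectralForm_self_le`).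

Uniqueness in law: a centered Gaussian process is determined by its covariance
(`identDistrib_of_covariance_eq`). This also gives stationarity, since a shift multiplies φ~ by a
unimodular factor that cancels in φ~ conj(ψ~).

Uniqueness of G: every complex Schwartz function is φ~ + iψ~ with φ, ψ real, so the covariance
determines ∫ χ dG_{j,j'} for every smooth compactly supported χ, hence the measure. -/

noncomputable section

namespace GenField

/-! ### Integration against a complex measure with a density. -/

section ComplexDensity

variable {α : Type*} [MeasurableSpace α] {μ : Measure α} {f g : α → ℂ}

theorem integrable_withDensity_enorm_iff (hg : AEStronglyMeasurable g μ) :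
    Integrable f (μ.withDensity fun x => ‖g x‖ₑ) ↔ Integrable (fun x => ‖g x‖ • f x) μ :=
  integrable_withDensity_iff_integrable_smul₀ (f := fun x => ‖g x‖₊) hg.nnnorm.aemeasurable

theorem integrable_mul_of_integrable_withDensity_enorm (hg : AEStronglyMeasurable g μ)
    (hf : Integrable f (μ.withDensity fun x => ‖g x‖ₑ)) : Integrable (fun x => f x * g x) μ := by
  rw [integrable_withDensity_enorm_iff hg] at hf
  refine hf.mono ?_ (ae_of_all _ fun x => ?_)
  -- `f` need not be measurable for `μ` itself, only `‖g‖ • f` is; multiplying by the phase `g /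
  -- ‖g‖` recovers the product. Where `g` vanishes, both sides are 0.
  · have h : (fun x => f x * g x) = fun x => (‖g x‖ • f x) * (g x * ((‖g x‖⁻¹ : ℝ) : ℂ)) := by
      funext x
      by_cases hx : g x = 0
      · simp [hx]
      · have hn : ((‖g x‖ : ℝ) : ℂ) ≠ 0 := by simpa using hx
        rw [Complex.real_smul, Complex.ofReal_inv]
        field_simp
    rw [h]
    refine hf.1.mul (hg.mul ?_)
    exact (Complex.measurable_ofReal.comp_aemeasurable
      hg.norm.aemeasurable.inv).aestronglyMeasurable
  · simp [mul_comm]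

theorem integrable_withDensity_enorm_of_integrable_mul (hg : AEStronglyMeasurable g μ)
    (hf : AEStronglyMeasurable f μ) (h : Integrable (fun x => f x * g x) μ) :
    Integrable f (μ.withDensity fun x => ‖g x‖ₑ) := by
  rw [integrable_withDensity_enorm_iff hg]
  exact h.mono (hg.norm.smul hf) (ae_of_all _ fun x => by simp [mul_comm])

theorem integral_norm_mul_eq (hg : AEStronglyMeasurable g μ) (f : α → ℂ) :
    ∫ x, ‖f x * g x‖ ∂μ = ∫ x, ‖f x‖ ∂(μ.withDensity fun x => ‖g x‖ₑ) := by
  have h := integral_withDensity_eq_integral_smul₀ (μ := μ) (f := fun x => ‖g x‖₊)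
    hg.nnnorm.aemeasurable fun x => ‖f x‖
  refine Eq.trans ?_ h.symm
  simp [NNReal.smul_def, mul_comm]

/-- The integral with respect to a complex measure with density `g`. -/
theorem integral_withDensityᵥ (hg : Integrable g μ)
    (hf : Integrable f (μ.withDensity fun x => ‖g x‖ₑ)) :
    (μ.withDensityᵥ g).integral f (ContinuousLinearMap.mul ℝ ℂ) = ∫ x, f x * g x ∂μ := by
  have hv : (μ.withDensityᵥ g).variation = μ.withDensity fun x => ‖g x‖ₑ :=
    Measure.variation_withDensityᵥ hg
  have hgm := hg.1
  rw [← hv] at hf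
  have hfin : IsFiniteMeasure (μ.withDensityᵥ g).variation := by
    rw [hv]
    exact isFiniteMeasure_withDensity hg.2.ne
  have hint : ∀ {f : α → ℂ}, Integrable f (μ.withDensityᵥ g).variation →
      Integrable (fun x => f x * g x) μ := fun hf => by
    rw [hv] at hf
    exact integrable_mul_of_integrable_withDensity_enorm hgm hf
  have hnorm : ∀ f : α → ℂ,
      ∫ x, ‖f x * g x‖ ∂μ = ∫ x, ‖f x‖ ∂(μ.withDensityᵥ g).variation := fun f => by
    rw [hv, integral_norm_mul_eq hgm]
  -- Both sides are additive and continuous for the L¹ norm of the variation, so indicators suffice.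
  refine Integrable.induction (μ := (μ.withDensityᵥ g).variation) (fun f =>
    (μ.withDensityᵥ g).integral f (ContinuousLinearMap.mul ℝ ℂ) = ∫ x, f x * g x ∂μ)
    ?_ ?_ ?_ ?_ hf
  · intro c s hs _
    rw [VectorMeasure.integral_indicator hs]
    have hfin' : IsFiniteMeasure ((μ.withDensityᵥ g).restrict s).variation := by
      rw [VectorMeasure.variation_restrict hs]
      infer_instance
    rw [VectorMeasure.integral_const, VectorMeasure.restrict_apply _ hs MeasurableSet.univ,
      Set.univ_inter, withDensityᵥ_apply hg hs, ← integral_indicator hs]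
    simp only [ContinuousLinearMap.mul_apply']
    rw [← integral_const_mul]
    congr 1 with x
    by_cases hx : x ∈ s <;> simp [hx]
  · intro f₁ f₂ _ h₁ h₂ e₁ e₂
    rw [VectorMeasure.integral_add h₁ h₂, e₁, e₂, ← integral_add (hint h₁) (hint h₂)]
    simp [add_mul]
  · refine isClosed_eq VectorMeasure.continuous_integral ?_
    refine (LipschitzWith.of_dist_le_mul (K := 1) fun a b => ?_).continuous
    rw [dist_eq_norm, ← integral_sub (hint (L1.integrable_coeFn a)) (hint (L1.integrable_coeFn b)),
      NNReal.coe_one, one_mul, dist_eq_norm, L1.norm_eq_integral_norm]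
    refine (norm_integral_le_integral_norm _).trans (le_of_eq ?_)
    have h : ∫ x, ‖(a - b) x‖ ∂(μ.withDensityᵥ g).variation
        = ∫ x, ‖a x - b x‖ ∂(μ.withDensityᵥ g).variation :=
      integral_congr_ae ((Lp.coeFn_sub a b).mono fun x hx => congrArg norm hx)
    rw [h, ← hnorm fun x => a x - b x]
    simp [sub_mul]
  · intro f₁ f₂ h h₁ e
    rw [← VectorMeasure.integral_congr_ae h, e]
    -- Almost everywhere equality for `‖g‖ dμ` says nothing where `g = 0`, but the integrands vanish
    -- there.
    have h' : ∀ᵐ x ∂μ, g x ≠ 0 → f₁ x = f₂ x := by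
      rw [hv] at h
      have := (ae_withDensity_iff' (hgm.enorm)).1 h
      filter_upwards [this] with x hx hne using hx (by simpa using hne)
    refine integral_congr_ae ?_
    filter_upwards [h'] with x hx
    by_cases h0 : g x = 0
    · simp [h0]
    · simp [hx h0]

end ComplexDensity

/-! ### Locally finite complex measures through their densities. -/

theorem iUnion_cube (ν : ℕ) : ⋃ n : ℕ, cube ν n = Set.univ := by
  refine Set.eq_univ_of_forall fun x => Set.mem_iUnion.2 ?_
  obtain ⟨n, hn⟩ := exists_nat_ge ‖x‖
  exact ⟨n, fun i => abs_le.1 ((PiLp.norm_apply_le x i).trans hn)⟩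

theorem cube_mono (ν : ℕ) : Monotone fun n : ℕ => cube ν n := fun m n h x hx i => by
  have h' : (m : ℝ) ≤ n := by exact_mod_cast h
  exact ⟨(neg_le_neg h').trans (hx i).1, (hx i).2.trans h'⟩

/-- The cube as a bounded Borel set. -/
def cubeSet (ν : ℕ) (T : ℝ) : BoundedBorel ν :=
  ⟨cube ν T, measurableSet_cube ν T, isBounded_cube ν T⟩

namespace LocComplexMeasure

variable {ν : ℕ} {G : LocComplexMeasure ν} {μ ρ : Measure (Space ν)} {g : Space ν → ℂ}

theorem IsDensity.integrableOn_cube (h : G.IsDensity μ g) (T : ℝ) :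
    IntegrableOn g (cube ν T) μ := (h (cubeSet ν T)).1

theorem IsDensity.aestronglyMeasurable (h : G.IsDensity μ g) : AEStronglyMeasurable g μ := by
  rw [← Measure.restrict_univ (μ := μ), ← iUnion_cube ν]
  exact AEStronglyMeasurable.iUnion fun n => (h.integrableOn_cube n).1

theorem IsDensity.onCube_eq (h : G.IsDensity μ g) (T : ℝ) :
    G.onCube T = (μ.restrict (cube ν T)).withDensityᵥ g := by
  ext A hA
  · rw [onCube_apply _ _ _ hA, (h _).2, withDensityᵥ_apply (h.integrableOn_cube T) hA,
      Measure.restrict_restrict hA]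
    rfl

theorem IsDensity.variation_onCube (h : G.IsDensity μ g) (T : ℝ) :
    (G.onCube T).variation = (μ.withDensity fun x => ‖g x‖ₑ).restrict (cube ν T) := by
  rw [h.onCube_eq, Measure.variation_withDensityᵥ (h.integrableOn_cube T),
    restrict_withDensity (measurableSet_cube ν T)]

theorem _root_.GenField.iSup_restrict_cube (m : Measure (Space ν)) :
    ⨆ n : ℕ, m.restrict (cube ν n) = m := by
  refine le_antisymm (iSup_le fun n => Measure.restrict_le_self) (Measure.le_intro fun s hs _ => ?_)
  have h : s = ⋃ n : ℕ, s ∩ cube ν n := by rw [← Set.inter_iUnion, iUnion_cube, Set.inter_univ]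
  have hm : Monotone fun n : ℕ => s ∩ cube ν n := fun i j hij =>
    Set.inter_subset_inter_right s (cube_mono ν hij)
  calc m s = ⨆ n : ℕ, m (s ∩ cube ν n) := by
        conv_lhs => rw [h]
        exact hm.measure_iUnion
    _ ≤ _ := iSup_le fun n => by
        rw [← Measure.restrict_apply hs]
        exact le_iSup (fun n : ℕ => m.restrict (cube ν n)) n s

theorem IsDensity.variation_eq (h : G.IsDensity μ g) :
    G.variation = μ.withDensity fun x => ‖g x‖ₑ := by
  simp_rw [variation, h.variation_onCube]
  exact iSup_restrict_cube _

/-- On each cube the integral is a set integral against `μ`; the limit over growing cubes exists by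
integrability on the whole space. -/
theorem IsDensity.hasIntegral (h : G.IsDensity μ g) {f : Space ν → ℂ}
    (hf : Measurable f) (hi : Integrable (fun x => f x * g x) μ) :
    G.HasIntegral f (∫ x, f x * g x ∂μ) := by
  have hF : Integrable f (μ.withDensity fun x => ‖g x‖ₑ) :=
    integrable_withDensity_enorm_of_integrable_mul h.aestronglyMeasurable
      hf.aestronglyMeasurable hi
  refine ⟨h.variation_eq ▸ hF, ?_⟩
  have h1 : ∀ n : ℕ, (G.onCube n).integral f (ContinuousLinearMap.mul ℝ ℂ)
      = ∫ x in cube ν n, f x * g x ∂μ := fun n => by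
    rw [h.onCube_eq]
    refine integral_withDensityᵥ (h.integrableOn_cube n) ?_
    rw [← restrict_withDensity (measurableSet_cube ν n)]
    exact hF.restrict
  simp_rw [h1]
  have h2 := tendsto_setIntegral_of_monotone (μ := μ) (f := fun x => f x * g x)
    (fun n : ℕ => measurableSet_cube ν n) (cube_mono ν) hi.integrableOn
  rwa [iUnion_cube, setIntegral_univ] at h2

theorem HasIntegral.unique {f : Space ν → ℂ} {z w : ℂ} (hz : G.HasIntegral f z)
    (hw : G.HasIntegral f w) : z = w := tendsto_nhds_unique hz.2 hw.2

/-- A density with respect to `μ` yields one with respect to any dominating measure. -/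
theorem IsDensity.of_absolutelyContinuous [SigmaFinite μ] [SigmaFinite ρ] (h : G.IsDensity μ g)
    (hμ : μ ≪ ρ) : G.IsDensity ρ fun x => (μ.rnDeriv ρ x).toReal • g x := fun A => by
  have hA := A.measurableSet
  refine ⟨?_, (h A).2.trans (setIntegral_rnDeriv_smul hμ hA).symm⟩
  have h1 := (h A).1
  rw [← integrable_indicator_iff hA] at h1 ⊢
  rw [← integrable_rnDeriv_smul_iff hμ] at h1
  refine h1.congr (ae_of_all _ fun x => ?_)
  by_cases hx : x ∈ A.carrier <;> simp [hx]

theorem IsDensity.locallyIntegrable (h : G.IsDensity μ g) : LocallyIntegrable g μ := fun x =>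
  ⟨Metric.ball x 1, Metric.ball_mem_nhds x one_pos,
    (h ⟨Metric.ball x 1, measurableSet_ball, Metric.isBounded_ball⟩).1⟩

/-- The measure `μ` need not be symmetric, so evenness is not a pointwise property of `g`. It
provides instead a second density of the same `G`, relative to the reflected measure. -/
theorem IsDensity.map_neg (h : G.IsDensity μ g) (he : G.IsEven) :
    G.IsDensity (μ.map Neg.neg) fun x => conj (g (-x)) := fun A => by
  have hA := A.measurableSet
  have hpre : (Neg.neg ⁻¹' A.carrier : Set (Space ν)) = A.neg.carrier := rfl
  have hN := MeasurableEquiv.neg (Space ν) |>.measurableEmbedding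
  refine ⟨?_, ?_⟩
  · have := (hN.integrableOn_map_iff (f := fun x => conj (g (-x))) (μ := μ) (s := A.carrier)).2
    refine this ?_
    have h2 := (h A.neg).1
    refine Integrable.congr (f := fun x => conj (g x)) ?_ (ae_of_all _ fun x => ?_)
    · exact (Complex.conjCLE : ℂ →L[ℝ] ℂ).integrable_comp h2
    · simp
  · have h1 := hN.setIntegral_map (μ := μ) (fun x => conj (g (-x))) A.carrier
    refine Eq.trans ?_ h1.symm
    have h3 := he A
    rw [(h A.neg).2] at h3
    rw [← Complex.conj_conj (G A), ← h3, ← integral_conj]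
    refine setIntegral_congr_fun A.neg.measurableSet fun x _ => ?_
    simp

end LocComplexMeasure

/-! ### The Fourier transform on real and complex Schwartz functions. -/

section Fourier

open scoped FourierTransform

variable {ν : ℕ}

/-- The linear automorphism `x ↦ -x / (2π)`. -/
def fourierScaling (ν : ℕ) : Space ν ≃L[ℝ] Space ν :=
  ContinuousLinearEquiv.smulLeft (Units.mk0 (-(2 * Real.pi)⁻¹ : ℝ) (by simp [Real.pi_ne_zero]))

theorem fourierScaling_apply (x : Space ν) : fourierScaling ν x = (-(2 * Real.pi)⁻¹ : ℝ) • x := rfl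

/-- The embedding of real into complex Schwartz functions. -/
def schwartzOfReal (ν : ℕ) : 𝓢(Space ν, ℝ) →L[ℝ] 𝓢(Space ν, ℂ) :=
  SchwartzMap.postcompCLM Complex.ofRealCLM

theorem schwartzOfReal_apply (φ : 𝓢(Space ν, ℝ)) (x : Space ν) :
    schwartzOfReal ν φ x = φ x := rfl

/-- The Fourier transform `f~(x) = ∫ exp(i(x,t)) f(t) dt` of complex Schwartz functions. -/
def complexFourierCLM (ν : ℕ) : 𝓢(Space ν, ℂ) →L[ℝ] 𝓢(Space ν, ℂ) :=
  SchwartzMap.compCLMOfContinuousLinearEquiv ℝ (fourierScaling ν) ∘L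
    SchwartzMap.fourierTransformCLM ℝ

/-- The transform `𝓕` has kernel exp(-2πi(x,t)); evaluating it at -x/(2π) produces exp(i(x,t)). -/
theorem complexFourierCLM_apply (f : 𝓢(Space ν, ℂ)) (x : Space ν) :
    complexFourierCLM ν f x
      = ∫ t : Space ν, Complex.exp (Complex.I * ((inner ℝ x t : ℝ) : ℂ)) * f t := by
  have h : complexFourierCLM ν f x = 𝓕 (f : Space ν → ℂ) (fourierScaling ν x) := rfl
  rw [h, Real.fourier_eq']
  refine integral_congr_ae (ae_of_all _ fun t => ?_)
  simp only [smul_eq_mul]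
  congr 2
  rw [fourierScaling_apply, real_inner_smul_right, real_inner_comm]
  have hpi : (Real.pi : ℂ) ≠ 0 := by exact_mod_cast Real.pi_ne_zero
  push_cast
  field_simp

/-- The Fourier transform of real Schwartz functions as a continuous linear map. -/
def fourierCLM (ν : ℕ) : 𝓢(Space ν, ℝ) →L[ℝ] 𝓢(Space ν, ℂ) :=
  complexFourierCLM ν ∘L schwartzOfReal ν

theorem fourierCLM_apply (φ : 𝓢(Space ν, ℝ)) (x : Space ν) :
    fourierCLM ν φ x = schwartzFourier φ x :=
  complexFourierCLM_apply (schwartzOfReal ν φ) x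

theorem fourierCLM_neg (φ : 𝓢(Space ν, ℝ)) (x : Space ν) :
    fourierCLM ν φ (-x) = conj (fourierCLM ν φ x) := by
  rw [fourierCLM_apply, fourierCLM_apply, schwartzFourier, schwartzFourier, ← integral_conj]
  refine integral_congr_ae (ae_of_all _ fun t => ?_)
  simp [← Complex.exp_conj]

theorem fourierCLM_shift (t : Space ν) (φ : 𝓢(Space ν, ℝ)) (x : Space ν) :
    fourierCLM ν (SchwartzMap.compSubConstCLM ℝ t φ) x
      = Complex.exp (Complex.I * ((inner ℝ x t : ℝ) : ℂ)) * fourierCLM ν φ x := by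
  rw [fourierCLM_apply, fourierCLM_apply, schwartzFourier, schwartzFourier, ← integral_const_mul,
    ← integral_add_right_eq_self _ t]
  refine integral_congr_ae (ae_of_all _ fun s => ?_)
  simp only [SchwartzMap.compSubConstCLM_apply, add_sub_cancel_right]
  rw [← mul_assoc, ← Complex.exp_add, inner_add_right]
  push_cast
  ring_nf

theorem fourierCLM_shift_mul_conj (t : Space ν) (φ ψ : 𝓢(Space ν, ℝ)) (x : Space ν) :
    fourierCLM ν (SchwartzMap.compSubConstCLM ℝ t φ) x
      * conj (fourierCLM ν (SchwartzMap.compSubConstCLM ℝ t ψ) x)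
      = fourierCLM ν φ x * conj (fourierCLM ν ψ x) := by
  rw [fourierCLM_shift, fourierCLM_shift, map_mul, mul_mul_mul_comm, Complex.mul_conj,
    Complex.normSq_eq_norm_sq, mul_comm Complex.I, Complex.norm_exp_ofReal_mul_I]
  simp

/-- Every complex Schwartz function is a combination of Fourier transforms of real ones. -/
theorem exists_fourierCLM_add_I_mul (f : 𝓢(Space ν, ℂ)) :
    ∃ φ ψ : 𝓢(Space ν, ℝ), ∀ x, f x = fourierCLM ν φ x + Complex.I * fourierCLM ν ψ x := by
  -- `h` is the preimage of `f` under `complexFourierCLM`; its real and imaginary parts are the two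
  -- witnesses.
  let h : 𝓢(Space ν, ℂ) :=
    𝓕⁻ (SchwartzMap.compCLMOfContinuousLinearEquiv ℝ (fourierScaling ν).symm f)
  have hf : f = complexFourierCLM ν h := by
    ext x
    have e : SchwartzMap.fourierTransformCLM ℝ h
        = SchwartzMap.compCLMOfContinuousLinearEquiv ℝ (fourierScaling ν).symm f := by
      have e' : SchwartzMap.fourierTransformCLM ℝ h = 𝓕 h := SchwartzMap.ext fun _ => rfl
      rw [e']
      exact FourierTransform.fourier_fourierInv_eq _
    rw [complexFourierCLM, ContinuousLinearMap.comp_apply, e]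
    simp
  have hh : h = schwartzOfReal ν (SchwartzMap.postcompCLM Complex.reCLM h)
      + Complex.I • schwartzOfReal ν (SchwartzMap.postcompCLM Complex.imCLM h) := by
    ext x
    simp [schwartzOfReal_apply, mul_comm Complex.I, Complex.re_add_im]
  refine ⟨SchwartzMap.postcompCLM Complex.reCLM h, SchwartzMap.postcompCLM Complex.imCLM h,
    fun x => ?_⟩
  conv_lhs => rw [hf, hh, map_add]
  rw [add_apply]
  congr 1
  rw [fourierCLM, ContinuousLinearMap.comp_apply, complexFourierCLM_apply, complexFourierCLM_apply,
    ← integral_const_mul]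
  refine integral_congr_ae (ae_of_all _ fun t => ?_)
  simp only [smul_apply, smul_eq_mul]
  ring

end Fourier

/-! ### Centered Gaussian processes and their covariance. -/

section Law

variable {T : Type*} {d : ℕ} {Ω : Type*} [MeasurableSpace Ω] {P : Measure Ω}
  {X : T → Ω → (Fin d → ℝ)}

theorem memLp_two_coordinate (hX : IsGaussianProcess X P) (t : T) (j : Fin d) :
    MemLp (fun ω => X t ω j) 2 P :=
  ((hX.hasGaussianLaw_eval t).eval j).memLp_two

theorem dual_restrict_eq_sum (I : Finset T) (L : StrongDual ℝ (I → Fin d → ℝ))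
    (x : T → Fin d → ℝ) [DecidableEq T] :
    L (I.restrict x) = ∑ k : I × Fin d, L (Pi.single k.1 (Pi.single k.2 1)) * x k.1 k.2 := by
  have h : I.restrict x
      = ∑ k : I × Fin d, x k.1 k.2 • (Pi.single k.1 (Pi.single k.2 1) : I → Fin d → ℝ) := by
    rw [Fintype.sum_prod_type]
    funext i j
    rw [Finset.sum_apply, Finset.sum_apply, Finset.sum_eq_single i, Finset.sum_apply,
      Finset.sum_apply, Finset.sum_eq_single j]
    · simp
    · intro b _ hb
      simp [hb.symm]
    · simp
    · intro b _ hb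
      simp [hb.symm]
    · simp
  rw [h, map_sum]
  exact Finset.sum_congr rfl fun k _ => by rw [map_smul, smul_eq_mul, mul_comm]

/-- A centered Gaussian variable has characteristic function exp(-Var/2) at 1. For a linear
functional of the coordinates the variance is a quadratic form in the covariances, so only these
enter. -/
theorem charFunDual_restrict_eq [DecidableEq T] (hX : IsGaussianProcess X P)
    (h0 : ∀ t j, ∫ ω, X t ω j ∂P = 0) (I : Finset T) (L : StrongDual ℝ (I → Fin d → ℝ)) :
    charFunDual (P.map fun ω => I.restrict (X · ω)) L
      = Complex.exp (-((∑ k : I × Fin d, ∑ l : I × Fin d,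
        L (Pi.single k.1 (Pi.single k.2 1)) * L (Pi.single l.1 (Pi.single l.2 1)) *
          ∫ ω, X k.1 ω k.2 * X l.1 ω l.2 ∂P : ℝ) : ℂ) / 2) := by
  have hP := hX.isProbabilityMeasure
  rw [(hX.hasGaussianLaw I).charFunDual_map_eq L]
  have hL : (L ∘ fun ω => I.restrict (X · ω)) = fun ω => ∑ k : I × Fin d,
      L (Pi.single k.1 (Pi.single k.2 1)) * X k.1 ω k.2 :=
    funext fun ω => dual_restrict_eq_sum I L (X · ω)
  have hm : ∀ k : I × Fin d, MemLp (fun ω => L (Pi.single k.1 (Pi.single k.2 1)) * X k.1 ω k.2) 2 P :=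
    fun k => (memLp_two_coordinate hX k.1 k.2).const_mul _
  have hmean : ∫ ω, (L ∘ fun ω => I.restrict (X · ω)) ω ∂P = 0 := by
    rw [hL, integral_finsetSum _ fun k _ => (hm k).integrable one_le_two]
    refine Finset.sum_eq_zero fun k _ => ?_
    rw [integral_const_mul, h0, mul_zero]
  rw [variance_eq_sub (by rw [hL]; exact memLp_finsetSum _ fun k _ => hm k), hmean]
  have hsq : ∫ ω, ((L ∘ fun ω => I.restrict (X · ω)) ^ 2) ω ∂P = ∑ k : I × Fin d, ∑ l : I × Fin d,
        L (Pi.single k.1 (Pi.single k.2 1)) * L (Pi.single l.1 (Pi.single l.2 1)) *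
          ∫ ω, X k.1 ω k.2 * X l.1 ω l.2 ∂P := by
    have hi : ∀ k l : I × Fin d, Integrable (fun ω => L (Pi.single k.1 (Pi.single k.2 1)) *
        X k.1 ω k.2 * (L (Pi.single l.1 (Pi.single l.2 1)) * X l.1 ω l.2)) P :=
      fun k l => (hm k).integrable_mul (hm l)
    simp_rw [Pi.pow_apply, hL, sq, Finset.sum_mul_sum]
    rw [integral_finsetSum _ fun k _ => integrable_finsetSum _ fun l _ => hi k l]
    refine Finset.sum_congr rfl fun k _ => ?_
    rw [integral_finsetSum _ fun l _ => hi k l]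
    refine Finset.sum_congr rfl fun l _ => ?_
    rw [← integral_const_mul]
    congr 1 with ω
    ring
  rw [hsq]
  congr 1
  push_cast
  ring

/-- A centered Gaussian process is determined in law by its covariance. -/
theorem identDistrib_of_covariance_eq {Ω' : Type*} [MeasurableSpace Ω'] {P' : Measure Ω'}
    {Y : T → Ω' → (Fin d → ℝ)} (hX : IsGaussianProcess X P) (hY : IsGaussianProcess Y P')
    (mX : ∀ t, Measurable (X t)) (mY : ∀ t, Measurable (Y t))
    (hX0 : ∀ t j, ∫ ω, X t ω j ∂P = 0) (hY0 : ∀ t j, ∫ ω, Y t ω j ∂P' = 0)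
    (hc : ∀ s t j k, ∫ ω, X s ω j * X t ω k ∂P = ∫ ω, Y s ω j * Y t ω k ∂P') :
    IdentDistrib (fun ω t => X t ω) (fun ω t => Y t ω) P P' := by
  classical
  have hP := hX.isProbabilityMeasure
  have hP' := hY.isProbabilityMeasure
  have aX : AEMeasurable (fun ω t => X t ω) P := (measurable_pi_lambda _ mX).aemeasurable
  have aY : AEMeasurable (fun ω t => Y t ω) P' := (measurable_pi_lambda _ mY).aemeasurable
  refine ⟨aX, aY, ?_⟩
  -- Both laws are projective limits of their finite dimensional marginals; once the marginals
  -- agree, uniqueness of the limit concludes.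
  have h1 := isProjectiveLimit_map aX
  have h2 := isProjectiveLimit_map aY
  have h : (fun I : Finset T => P.map fun ω => I.restrict (X · ω))
      = fun I : Finset T => P'.map fun ω => I.restrict (Y · ω) := by
    funext I
    have g1 := (hX.hasGaussianLaw I).isGaussian_map
    have g2 := (hY.hasGaussianLaw I).isGaussian_map
    refine Measure.ext_of_charFunDual (funext fun L => ?_)
    rw [charFunDual_restrict_eq hX hX0, charFunDual_restrict_eq hY hY0]
    simp_rw [hc]
  have hfin : ∀ I : Finset T, IsFiniteMeasure (P'.map fun ω => I.restrict (Y · ω)) :=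
    fun I => inferInstance
  rw [h] at h1
  exact h1.unique h2

end Law

/-! ### From a covariance form to an isonormal Gaussian process. -/

/-- A positive semidefinite symmetric bilinear form is the pullback of the inner product of a
Hilbert space. -/
theorem exists_hilbert_of_bilinForm {V : Type} [AddCommGroup V] [Module ℝ V]
    (B : V →ₗ[ℝ] V →ₗ[ℝ] ℝ) (hs : ∀ v w, B v w = B w v) (hp : ∀ v, 0 ≤ B v v) :
    ∃ (H : Type) (_ : NormedAddCommGroup H) (_ : InnerProductSpace ℝ H) (_ : CompleteSpace H)
      (U : V →ₗ[ℝ] H), ∀ v w, inner ℝ (U v) (U w) = B v w := by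
  let c : PreInnerProductSpace.Core ℝ V :=
    { inner := fun v w => B v w
      conj_inner_symm := fun v w => by simp [hs w v]
      re_inner_nonneg := fun v => by simpa using hp v
      add_left := fun u v w => by simp
      smul_left := fun v w r => by simp }
  let i1 : SeminormedAddCommGroup V := InnerProductSpace.Core.toSeminormedAddCommGroup (𝕜 := ℝ) (c := c)
  let i2 : InnerProductSpace ℝ V := InnerProductSpace.ofCore c
  -- The form may have null vectors, so `V` is only seminormed; its Hausdorff completion also
  -- identifies vectors at distance 0.
  refine ⟨UniformSpace.Completion V, inferInstance, inferInstance, inferInstance,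
    (UniformSpace.Completion.toComplₗᵢ (𝕜 := ℝ) (E := V)).toLinearMap, fun v w => ?_⟩
  exact UniformSpace.Completion.inner_coe v w

section Isonormal

variable {Ω : Type*} [MeasurableSpace Ω] {P : Measure Ω} [IsProbabilityMeasure P]

/-- The map is Lipschitz, as |exp(ia) - exp(ib)| ≤ |a - b| and the L¹ norm is at most the L² norm on
a probability space. It lets Gaussianity pass to L² limits. -/
theorem continuous_integral_exp_mul_I (t : ℝ) :
    Continuous fun Y : Lp ℝ 2 P => ∫ ω, Complex.exp (t * Y ω * Complex.I) ∂P := by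
  have hint : ∀ Y : Lp ℝ 2 P, Integrable (fun ω => Complex.exp (t * Y ω * Complex.I)) P := fun Y => by
    refine Integrable.of_bound (C := 1) ?_ (ae_of_all _ fun ω => ?_)
    · have := (Lp.stronglyMeasurable Y).measurable
      exact Measurable.aestronglyMeasurable (by fun_prop)
    · rw [← Complex.ofReal_mul, Complex.norm_exp_ofReal_mul_I]
  refine (LipschitzWith.of_dist_le_mul (K := ‖t‖₊) fun a b => ?_).continuous
  rw [dist_eq_norm, ← integral_sub (hint a) (hint b), dist_eq_norm]
  have hab : MemLp (fun ω => a ω - b ω) 2 P := (Lp.memLp a).sub (Lp.memLp b)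
  calc ‖∫ ω, (Complex.exp (t * a ω * Complex.I) - Complex.exp (t * b ω * Complex.I)) ∂P‖
      ≤ ∫ ω, ‖Complex.exp (t * a ω * Complex.I) - Complex.exp (t * b ω * Complex.I)‖ ∂P :=
        norm_integral_le_integral_norm _
    _ ≤ ∫ ω, |t| * ‖a ω - b ω‖ ∂P := by
        refine integral_mono ((hint a).sub (hint b)).norm
          ((hab.integrable one_le_two).norm.const_mul _) fun ω => ?_
        have h1 : Complex.exp (t * a ω * Complex.I) - Complex.exp (t * b ω * Complex.I)
            = Complex.exp ((t * b ω : ℝ) * Complex.I)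
              * (Complex.exp (Complex.I * (t * (a ω - b ω) : ℝ)) - 1) := by
          rw [mul_sub, ← Complex.exp_add, mul_one]
          push_cast
          ring_nf
        simp only []
        rw [h1, norm_mul, Complex.norm_exp_ofReal_mul_I, one_mul]
        refine Real.norm_exp_I_mul_ofReal_sub_one_le.trans (le_of_eq ?_)
        rw [Real.norm_eq_abs, abs_mul, Real.norm_eq_abs]
    _ = |t| * ∫ ω, ‖a ω - b ω‖ ∂P := integral_const_mul _ _
    _ ≤ |t| * ‖a - b‖ := by
        refine mul_le_mul_of_nonneg_left ?_ (abs_nonneg t)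
        have h2 := eLpNorm_le_eLpNorm_of_exponent_le (p := 1) (q := 2) one_le_two hab.1
        rw [integral_norm_eq_lintegral_enorm hab.1, ← eLpNorm_one_eq_lintegral_enorm, Lp.norm_def,
          eLpNorm_congr_ae (Lp.coeFn_sub a b)]
        exact ENNReal.toReal_mono hab.2.ne h2
    _ = _ := by simp

/-- An isonormal Gaussian process over a real Hilbert space. -/
theorem exists_isonormal (H : Type) [NormedAddCommGroup H] [InnerProductSpace ℝ H]
    [CompleteSpace H] :
    ∃ (Ω : Type) (_ : MeasurableSpace Ω) (P : Measure Ω) (_ : IsProbabilityMeasure P)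
      (W : H →ₗᵢ[ℝ] Lp ℝ 2 P), ∀ h : H, P.map (W h) = gaussianReal 0 (‖h‖₊ ^ 2) := by
  classical
  obtain ⟨w, b, -⟩ := exists_hilbertBasis ℝ H
  let P : Measure (w → ℝ) := Measure.infinitePi fun _ => gaussianReal 0 1
  have hev : ∀ i : w, MeasurePreserving (Function.eval i) P (gaussianReal 0 1) :=
    fun i => measurePreserving_eval_infinitePi _ i
  have hmem : ∀ i : w, MemLp (fun ω : w → ℝ => ω i) 2 P := fun i =>
    (memLp_id_gaussianReal' 2 (by simp)).comp_measurePreserving (hev i)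
  -- The coordinates are independent standard Gaussians, hence orthonormal in L²; `W` sends the
  -- Hilbert basis of `H` to them.
  let ξ : w → Lp ℝ 2 P := fun i => (hmem i).toLp
  have hind : iIndepFun (fun i (ω : w → ℝ) => ω i) P :=
    iIndepFun_infinitePi (X := fun _ x => x) fun _ => measurable_id
  have hmap : ∀ (i : w) (f : ℝ → ℝ), Measurable f →
      ∫ ω, f (ω i) ∂P = ∫ x, f x ∂gaussianReal 0 1 := fun i f hf => by
    rw [← (hev i).map_eq, integral_map (hev i).measurable.aemeasurable hf.aestronglyMeasurable]
  have hmean : ∀ i : w, ∫ ω, ω i ∂P = 0 := fun i =>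
    (hmap i id measurable_id).trans integral_id_gaussianReal
  have hξ : Orthonormal ℝ ξ := by
    rw [orthonormal_iff_ite]
    intro i j
    have h1 : inner ℝ (ξ i) (ξ j) = ∫ ω, ω i * ω j ∂P := by
      rw [L2.inner_def]
      refine integral_congr_ae ?_
      filter_upwards [(hmem i).coeFn_toLp, (hmem j).coeFn_toLp] with ω hi hj
      simp [ξ, hi, hj, mul_comm]
    rw [h1]
    split_ifs with hij
    · subst hij
      have h2 : ∫ ω, ω i * ω i ∂P = ∫ x, x * x ∂gaussianReal 0 1 :=
        hmap i (fun x => x * x) (by fun_prop)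
      have h3 := variance_eq_sub (μ := gaussianReal 0 1) (X := id) (memLp_id_gaussianReal' 2 (by simp))
      rw [variance_id_gaussianReal] at h3
      rw [h2]
      simpa [sq] using h3.symm
    · rw [(hind.indepFun hij).integral_fun_mul_eq_mul_integral (hmem i).1 (hmem j).1, hmean, zero_mul]
  let W : H →ₗᵢ[ℝ] Lp ℝ 2 P :=
    hξ.orthogonalFamily.linearIsometry.comp b.repr.toLinearIsometry
  have hW : ∀ i, W (b i) = ξ i := fun i => by
    have h1 : W (b i) = hξ.orthogonalFamily.linearIsometry (lp.single 2 i 1) :=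
      congrArg hξ.orthogonalFamily.linearIsometry (b.repr_self i)
    rw [h1, hξ.orthogonalFamily.linearIsometry_apply_single]
    simp
  refine ⟨w → ℝ, inferInstance, P, inferInstance, W, fun h => ?_⟩
  -- For a finite combination of basis vectors, independence factors the characteristic function.
  -- The identity is closed in `h` and the span of the basis is dense.
  have key : ∀ (t : ℝ) (h : H), ∫ ω, Complex.exp (t * W h ω * Complex.I) ∂P
      = Complex.exp (-((‖h‖ ^ 2 * t ^ 2 : ℝ) : ℂ) / 2) := fun t => by
    have hc : IsClosed {h : H | ∫ ω, Complex.exp (t * W h ω * Complex.I) ∂P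
        = Complex.exp (-((‖h‖ ^ 2 * t ^ 2 : ℝ) : ℂ) / 2)} :=
      isClosed_eq ((continuous_integral_exp_mul_I t).comp W.continuous) (by fun_prop)
    have hspan : ((Submodule.span ℝ (Set.range b) : Submodule ℝ H) : Set H)
        ⊆ {h : H | ∫ ω, Complex.exp (t * W h ω * Complex.I) ∂P
          = Complex.exp (-((‖h‖ ^ 2 * t ^ 2 : ℝ) : ℂ) / 2)} := by
      intro h hh
      obtain ⟨c, rfl⟩ := Finsupp.mem_span_range_iff_exists_finsupp.1 hh
      have hnorm : ‖c.sum fun i a => a • b i‖ ^ 2 = ∑ i ∈ c.support, c i ^ 2 := by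
        rw [← real_inner_self_eq_norm_sq, Finsupp.sum, b.orthonormal.inner_sum]
        exact Finset.sum_congr rfl fun i _ => by simp [sq]
      have hae : ∀ᵐ ω ∂P, W (c.sum fun i a => a • b i) ω = ∑ i ∈ c.support, c i * ω i := by
        have h1 : W (c.sum fun i a => a • b i) = ∑ i ∈ c.support, c i • ξ i := by
          simp [Finsupp.sum, hW]
        rw [h1]
        have h2 : ∀ᵐ ω ∂P, ∀ i ∈ c.support, (c i • ξ i : Lp ℝ 2 P) ω = c i * ω i := by
          refine (ae_ball_iff c.support.countable_toSet).2 fun i _ => ?_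
          filter_upwards [Lp.coeFn_smul (c i) (ξ i), (hmem i).coeFn_toLp] with ω e1 e2
          rw [e1, Pi.smul_apply, e2, smul_eq_mul]
        filter_upwards [Lp.coeFn_finsetSum c.support fun i => c i • ξ i, h2] with ω e1 e2
        rw [e1, Finset.sum_apply]
        exact Finset.sum_congr rfl e2
      have hmc : ∀ i : w, Measurable fun ω : w → ℝ => c i * ω i := fun i =>
        Measurable.const_mul (f := fun ω : w → ℝ => ω i) (measurable_pi_apply i) (c i)
      have hcf : iIndepFun (fun i (ω : w → ℝ) => c i * ω i) P :=
        hind.comp (fun i x => c i * x) fun i => measurable_const_mul (c i)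
      have hcf' : iIndepFun (c.support.restrict fun i (ω : w → ℝ) => c i * ω i) P :=
        hcf.precomp (g := fun i : c.support => (i : w)) Subtype.val_injective
      have hprod := iIndepFun.charFun_map_fun_finsetSum_eq_prod (P := P) (s := c.support)
        (X := fun i (ω : w → ℝ) => c i * ω i) (fun i _ => (hmc i).aemeasurable) hcf'
      have hprod := congrFun hprod t
      rw [charFun_apply_real, integral_map
        (Finset.measurable_fun_sum _ fun i _ => hmc i).aemeasurable (by fun_prop), Finset.prod_apply] at hprod
      have hlhs : ∫ ω, Complex.exp (t * W (c.sum fun i a => a • b i) ω * Complex.I) ∂P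
          = ∫ ω, Complex.exp (t * ((∑ i ∈ c.support, c i * ω i : ℝ) : ℂ) * Complex.I) ∂P :=
        integral_congr_ae (hae.mono fun ω e => by simp only [e])
      rw [Set.mem_ofPred_eq, hlhs, hprod, hnorm, Finset.sum_mul, Complex.ofReal_sum,
        ← Finset.sum_neg_distrib, Finset.sum_div, Complex.exp_sum]
      refine Finset.prod_congr rfl fun i _ => ?_
      have hlaw : P.map (fun ω : w → ℝ => c i * ω i)
          = (gaussianReal 0 1).map fun x => c i * x := by
        rw [← (hev i).map_eq, Measure.map_map (by fun_prop) (hev i).measurable]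
        rfl
      rw [hlaw, gaussianReal_map_const_mul, charFun_gaussianReal]
      congr 1
      simp
      ring
    intro h
    have hd : h ∈ closure ((Submodule.span ℝ (Set.range b) : Submodule ℝ H) : Set H) := by
      rw [← Submodule.topologicalClosure_coe, b.dense_span]
      trivial
    exact hc.closure_subset_iff.2 hspan hd
  have hm : Measurable (W h) := (Lp.stronglyMeasurable _).measurable
  have := Measure.isProbabilityMeasure_map (μ := P) hm.aemeasurable
  refine Measure.ext_of_charFun (funext fun t => ?_)
  rw [charFun_gaussianReal, charFun_apply_real, integral_map hm.aemeasurable (by fun_prop), key]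
  congr 1
  push_cast
  simp
  ring

end Isonormal

section IsonormalProcess

variable {Ω : Type*} [MeasurableSpace Ω] {P : Measure Ω}
  {H : Type*} [NormedAddCommGroup H] [InnerProductSpace ℝ H] {W : H →ₗᵢ[ℝ] Lp ℝ 2 P}

/-- By linearity of `W`, a linear combination of the variables `W h` is again almost surely one of
them, so one dimensional Gaussianity gives joint Gaussianity. -/
theorem isGaussianProcess_isonormal (hW : ∀ h, P.map (W h) = gaussianReal 0 (‖h‖₊ ^ 2)) :
    IsGaussianProcess (fun h ω => W h ω) P where
  hasGaussianLaw I := by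
    classical
    have hm : Measurable fun ω => I.restrict fun h => W h ω :=
      measurable_pi_lambda _ fun i => (Lp.stronglyMeasurable _).measurable
    refine ⟨isGaussian_of_map_eq_gaussianReal fun L => ?_⟩
    have hL : ∀ x : H → ℝ, L (I.restrict x) = ∑ i : I, L (Pi.single i 1) * x i := fun x => by
      have h : I.restrict x = ∑ i : I, x i • (Pi.single i 1 : I → ℝ) := by
        funext j
        simp [Finset.sum_apply, Pi.single_apply]
      rw [h, map_sum]
      exact Finset.sum_congr rfl fun k _ => by rw [map_smul, smul_eq_mul, mul_comm]
    refine ⟨0, ‖∑ i : I, L (Pi.single i 1) • (i : H)‖₊ ^ 2, ?_⟩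
    rw [← hW, Measure.map_map L.continuous.measurable hm]
    refine Measure.map_congr ?_
    have h1 : W (∑ i : I, L (Pi.single i 1) • (i : H)) = ∑ i : I, L (Pi.single i 1) • W i := by simp
    rw [h1]
    have h2 : ∀ᵐ ω ∂P, ∀ i : I, (L (Pi.single i 1) • W i : Lp ℝ 2 P) ω
        = L (Pi.single i 1) * W i ω :=
      ae_all_iff.2 fun i => Lp.coeFn_smul (L (Pi.single i 1)) (W i)
    filter_upwards [Lp.coeFn_finsetSum Finset.univ fun i : I => L (Pi.single i 1) • W i, h2]
      with ω e1 e2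
    rw [e1, Finset.sum_apply, Function.comp_apply, hL]
    exact Finset.sum_congr rfl fun i _ => (e2 i).symm

theorem integral_isonormal (hW : ∀ h, P.map (W h) = gaussianReal 0 (‖h‖₊ ^ 2)) (h : H) :
    ∫ ω, W h ω ∂P = 0 := by
  have hm : Measurable (W h) := (Lp.stronglyMeasurable _).measurable
  have e : ∫ ω, W h ω ∂P = ∫ x, x ∂(P.map (W h)) :=
    (integral_map (f := fun x => x) hm.aemeasurable (by fun_prop)).symm
  rw [e, hW, integral_id_gaussianReal]

theorem integral_mul_isonormal (W : H →ₗᵢ[ℝ] Lp ℝ 2 P) (h k : H) :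
    ∫ ω, W h ω * W k ω ∂P = inner ℝ h k := by
  rw [← W.inner_map_map, L2.inner_def]
  exact integral_congr_ae (ae_of_all _ fun ω => by simp [mul_comm])

end IsonormalProcess

/-! ### The spectral form and its positivity. -/

/-- The determinant of the 2×2 submatrix on rows and columns `i`, `j` is nonnegative, so |A i j|² ≤
|A i i| |A j j|. This controls the off-diagonal measures, on which no growth condition is imposed.
-/
theorem _root_.Matrix.PosSemidef.norm_apply_le {n : Type*} [Fintype n] {A : Matrix n n ℂ}
    (hA : A.PosSemidef) (i j : n) : ‖A i j‖ ≤ ‖A i i‖ + ‖A j j‖ := by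
  have h := (hA.submatrix ![i, j]).det_nonneg
  rw [Matrix.det_fin_two] at h
  simp only [Matrix.submatrix_apply, Matrix.cons_val_zero, Matrix.cons_val_one] at h
  have hij : A j i = conj (A i j) := (hA.isHermitian.apply j i).symm
  rw [hij, Complex.mul_conj, Complex.normSq_eq_norm_sq, sub_nonneg] at h
  have h' : ‖A i j‖ ^ 2 ≤ ‖A i i‖ * ‖A j j‖ := by
    have h2 := (Complex.le_def.1 h).1
    rw [Complex.ofReal_re] at h2
    exact h2.trans ((Complex.re_le_norm _).trans (norm_mul _ _).le)
  refine abs_le_of_sq_le_sq' ?_ (by positivity) |>.2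
  nlinarith [norm_nonneg (A i i), norm_nonneg (A j j)]

variable {ν d : ℕ} {G : Fin d → Fin d → LocComplexMeasure ν}

/-- This places Schwartz functions in L² of the diagonal variations, continuously. Temperate growth
asks for a natural exponent, so `r` is rounded up. -/
theorem IsModeratelyIncreasing.hasTemperateGrowth (h : IsModeratelyIncreasing G) (j : Fin d) :
    (G j j).variation.HasTemperateGrowth := by
  obtain ⟨r, _, hr⟩ := h
  obtain ⟨n, hn⟩ := exists_nat_ge r
  refine ⟨n, ?_⟩
  have hm : ∀ s : ℝ, Measurable fun x : Space ν => (1 + ‖x‖) ^ s := fun s => by fun_prop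
  have hI : Integrable (fun x : Space ν => (1 + ‖x‖) ^ (-r)) (G j j).variation := by
    refine ⟨(hm _).aestronglyMeasurable, ?_⟩
    rw [hasFiniteIntegral_iff_ofReal (ae_of_all _ fun x => by positivity)]
    exact hr j
  refine hI.mono (hm _).aestronglyMeasurable (ae_of_all _ fun x => ?_)
  rw [Real.norm_of_nonneg (by positivity), Real.norm_of_nonneg (by positivity)]
  exact Real.rpow_le_rpow_of_exponent_le (by simp) (neg_le_neg hn)

/-- A spectral measure together with its matrix of densities. -/
structure HasSpectralDensity (G : Fin d → Fin d → LocComplexMeasure ν) (μ : Measure (Space ν))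
    (g : Space ν → Matrix (Fin d) (Fin d) ℂ) : Prop where
  isDensity : ∀ j j', (G j j').IsDensity μ fun x => g x j j'
  posSemidef : ∀ᵐ x ∂μ, (g x).PosSemidef
  moderate : IsModeratelyIncreasing G

namespace HasSpectralDensity

variable {μ : Measure (Space ν)} {g : Space ν → Matrix (Fin d) (Fin d) ℂ}

theorem integrable (h : HasSpectralDensity G μ g) (j j' : Fin d) (f k : 𝓢(Space ν, ℂ)) :
    Integrable (fun x => f x * conj (k x) * g x j j') μ := by
  have hdiag : ∀ i, Integrable (fun x => f x * conj (k x) * g x i i) μ := fun i => by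
    have := h.moderate.hasTemperateGrowth i
    have hf := f.memLp 2 (G i i).variation
    have hk : MemLp (fun x => conj (k x)) 2 (G i i).variation := (k.memLp 2 _).star
    have hfk : Integrable (fun x => f x * conj (k x)) (G i i).variation := hf.integrable_mul hk
    rw [(h.isDensity i i).variation_eq] at hfk
    exact integrable_mul_of_integrable_withDensity_enorm (h.isDensity i i).aestronglyMeasurable hfk
  refine ((hdiag j).norm.add (hdiag j').norm).mono ?_ ?_
  · have hc : Continuous fun x => f x * conj (k x) :=
      f.continuous.mul (Complex.continuous_conj.comp k.continuous)
    exact hc.aestronglyMeasurable.mul (h.isDensity j j').aestronglyMeasurable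
  · filter_upwards [h.posSemidef] with x hx
    simp only [Pi.add_apply]
    rw [Real.norm_of_nonneg (by positivity), norm_mul _ (g x j j'), norm_mul _ (g x j j),
      norm_mul _ (g x j' j'), ← mul_add]
    exact mul_le_mul_of_nonneg_left (hx.norm_apply_le j j') (norm_nonneg _)

/-- The sesquilinear form `∫ φ~ conj ψ~ dG j j'`. -/
def _root_.GenField.spectralForm (μ : Measure (Space ν)) (g : Space ν → Matrix (Fin d) (Fin d) ℂ)
    (j j' : Fin d) (φ ψ : 𝓢(Space ν, ℝ)) : ℂ :=
  ∫ x, fourierCLM ν φ x * conj (fourierCLM ν ψ x) * g x j j' ∂μ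

theorem hasIntegral (h : HasSpectralDensity G μ g) (j j' : Fin d) (φ ψ : 𝓢(Space ν, ℝ)) :
    (G j j').HasIntegral (fun x => schwartzFourier φ x * conj (schwartzFourier ψ x))
      (spectralForm μ g j j' φ ψ) := by
  simp_rw [← fourierCLM_apply]
  refine (h.isDensity j j').hasIntegral ?_ (h.integrable j j' _ _)
  exact ((fourierCLM ν φ).continuous.mul
    (Complex.continuous_conj.comp (fourierCLM ν ψ).continuous)).measurable

theorem spectralForm_eq_of_hasSpectralRepresentation (h : HasSpectralDensity G μ g) {j j' : Fin d}
    {r : 𝓢(Space ν, ℝ) → 𝓢(Space ν, ℝ) → ℝ} (hr : HasSpectralRepresentation (G j j') r)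
    (φ ψ : 𝓢(Space ν, ℝ)) : spectralForm μ g j j' φ ψ = r φ ψ :=
  (h.hasIntegral j j' φ ψ).unique (hr φ ψ)

/-- For real φ one has φ~(-x) = conj(φ~(x)). Computing the integral with the reflected density of
`IsDensity.map_neg` therefore gives the conjugate of its value. -/
theorem conj_spectralForm (h : HasSpectralDensity G μ g) {j j' : Fin d} (he : (G j j').IsEven)
    (φ ψ : 𝓢(Space ν, ℝ)) : conj (spectralForm μ g j j' φ ψ) = spectralForm μ g j j' φ ψ := by
  have hN := (MeasurableEquiv.neg (Space ν)).measurableEmbedding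
  have hcong : ∀ x, fourierCLM ν φ (-x) * conj (fourierCLM ν ψ (-x)) * conj (g (- -x) j j')
      = conj (fourierCLM ν φ x * conj (fourierCLM ν ψ x) * g x j j') := fun x => by
    simp [fourierCLM_neg]
  have hi : Integrable (fun x => fourierCLM ν φ x * conj (fourierCLM ν ψ x) * conj (g (-x) j j'))
      (μ.map Neg.neg) := by
    refine hN.integrable_map_iff.2 ?_
    refine Integrable.congr ?_ (ae_of_all _ fun x => (hcong x).symm)
    exact (Complex.conjCLE : ℂ →L[ℝ] ℂ).integrable_comp (h.integrable j j' _ _)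
  have h1 := ((h.isDensity j j').map_neg he).hasIntegral
    ((fourierCLM ν φ).continuous.mul
      (Complex.continuous_conj.comp (fourierCLM ν ψ).continuous)).measurable hi
  have h2 := h.hasIntegral j j' φ ψ
  simp_rw [← fourierCLM_apply] at h2
  have h3 := h2.unique h1
  refine Eq.trans ?_ h3.symm
  rw [spectralForm, ← integral_conj]
  refine Eq.trans ?_ (hN.integral_map _).symm
  exact integral_congr_ae (ae_of_all _ fun x => (hcong x).symm)

theorem ofReal_re_spectralForm (h : HasSpectralDensity G μ g) {j j' : Fin d}
    (he : (G j j').IsEven) (φ ψ : 𝓢(Space ν, ℝ)) :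
    (((spectralForm μ g j j' φ ψ).re : ℝ) : ℂ) = spectralForm μ g j j' φ ψ :=
  Complex.conj_eq_iff_re.1 (h.conj_spectralForm he φ ψ)

theorem spectralForm_shift (t : Space ν) (j j' : Fin d) (φ ψ : 𝓢(Space ν, ℝ)) :
    spectralForm μ g j j' (SchwartzMap.compSubConstCLM ℝ t φ) (SchwartzMap.compSubConstCLM ℝ t ψ)
      = spectralForm μ g j j' φ ψ := by
  simp_rw [spectralForm, fourierCLM_shift_mul_conj]

/-- The covariance form on vectors of Schwartz functions. -/
def covForm (h : HasSpectralDensity G μ g) :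
    (Fin d → 𝓢(Space ν, ℝ)) →ₗ[ℝ] (Fin d → 𝓢(Space ν, ℝ)) →ₗ[ℝ] ℝ :=
  -- Taking real parts loses nothing for even measures, by `ofReal_re_spectralForm`.
  LinearMap.mk₂ ℝ (fun v w => ∑ j, ∑ j', (spectralForm μ g j j' (v j) (w j')).re)
    (fun v v' w => by
      simp_rw [← Finset.sum_add_distrib, spectralForm]
      refine Finset.sum_congr rfl fun j _ => Finset.sum_congr rfl fun j' _ => ?_
      rw [← Complex.add_re, ← integral_add (h.integrable j j' _ _) (h.integrable j j' _ _)]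
      simp [add_mul])
    (fun c v w => by
      simp_rw [smul_eq_mul, Finset.mul_sum, spectralForm]
      refine Finset.sum_congr rfl fun j _ => Finset.sum_congr rfl fun j' _ => ?_
      rw [← Complex.re_ofReal_mul, ← integral_const_mul]
      simp [mul_assoc])
    (fun v w w' => by
      simp_rw [← Finset.sum_add_distrib, spectralForm]
      refine Finset.sum_congr rfl fun j _ => Finset.sum_congr rfl fun j' _ => ?_
      rw [← Complex.add_re, ← integral_add (h.integrable j j' _ _) (h.integrable j j' _ _)]
      simp [add_mul, mul_add])
    (fun c v w => by
      simp_rw [smul_eq_mul, Finset.mul_sum, spectralForm]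
      refine Finset.sum_congr rfl fun j _ => Finset.sum_congr rfl fun j' _ => ?_
      rw [← Complex.re_ofReal_mul, ← integral_const_mul]
      simp [mul_assoc, mul_left_comm])

theorem covForm_apply (h : HasSpectralDensity G μ g) (v w : Fin d → 𝓢(Space ν, ℝ)) :
    h.covForm v w = ∑ j, ∑ j', (spectralForm μ g j j' (v j) (w j')).re := rfl

theorem covForm_single (h : HasSpectralDensity G μ g) (j j' : Fin d) (φ ψ : 𝓢(Space ν, ℝ)) :
    h.covForm (Pi.single j φ) (Pi.single j' ψ) = (spectralForm μ g j j' φ ψ).re := by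
  rw [covForm_apply, Finset.sum_eq_single j, Finset.sum_eq_single j']
  · simp
  · intro i _ hi
    simp [spectralForm, hi]
  · simp
  · intro i _ hi
    simp [spectralForm, hi]
  · simp

theorem covForm_symm (h : HasSpectralDensity G μ g) (v w : Fin d → 𝓢(Space ν, ℝ)) :
    h.covForm v w = h.covForm w v := by
  rw [covForm_apply, covForm_apply, Finset.sum_comm]
  refine Finset.sum_congr rfl fun j _ => Finset.sum_congr rfl fun j' _ => ?_
  rw [← Complex.conj_re, spectralForm, spectralForm, ← integral_conj]
  congr 1
  refine integral_congr_ae ?_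
  filter_upwards [h.posSemidef] with x hx
  have hij : g x j j' = conj (g x j' j) := (hx.isHermitian.apply j j').symm
  rw [hij]
  simp only [map_mul, Complex.conj_conj]
  ring

theorem covForm_nonneg (h : HasSpectralDensity G μ g) (v : Fin d → 𝓢(Space ν, ℝ)) :
    0 ≤ h.covForm v v := by
  simp_rw [covForm_apply, spectralForm, ← Complex.re_sum]
  have e : ∑ j, ∑ j', ∫ x, fourierCLM ν (v j) x * conj (fourierCLM ν (v j') x) * g x j j' ∂μ
      = ∫ x, ∑ j, ∑ j', fourierCLM ν (v j) x * conj (fourierCLM ν (v j') x) * g x j j' ∂μ := by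
    rw [integral_finsetSum _ fun j _ => integrable_finsetSum _ fun j' _ => h.integrable j j' _ _]
    exact Finset.sum_congr rfl fun j _ =>
      (integral_finsetSum _ fun j' _ => h.integrable j j' _ _).symm
  have hi : Integrable (fun x => ∑ j, ∑ j',
      fourierCLM ν (v j) x * conj (fourierCLM ν (v j') x) * g x j j') μ :=
    integrable_finsetSum _ fun j _ => integrable_finsetSum _ fun j' _ => h.integrable j j' _ _
  rw [e]
  have e2 := integral_re hi
  refine le_of_le_of_eq ?_ e2
  refine integral_nonneg_of_ae ?_
  filter_upwards [h.posSemidef] with x hx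
  -- The integrand is the quadratic form of `g x`. Its left vector gets conjugated, hence the
  -- conjugate in the test vector.
  have h1 := hx.re_dotProduct_nonneg fun j => conj (fourierCLM ν (v j) x)
  refine le_of_le_of_eq h1 (congrArg _ ?_)
  simp only [dotProduct, Matrix.mulVec, Pi.star_apply, Finset.mul_sum]
  refine Finset.sum_congr rfl fun j _ => Finset.sum_congr rfl fun j' _ => ?_
  simp
  ring

theorem re_spectralForm_self_le (h : HasSpectralDensity G μ g) (j : Fin d) (φ : 𝓢(Space ν, ℝ))
    [(G j j).variation.HasTemperateGrowth] :
    (spectralForm μ g j j φ φ).re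
      ≤ ‖SchwartzMap.toLpCLM ℝ ℂ 2 (G j j).variation (fourierCLM ν φ)‖ ^ 2 := by
  have h1 : ‖SchwartzMap.toLpCLM ℝ ℂ 2 (G j j).variation (fourierCLM ν φ)‖ ^ 2
      = ∫ x, ‖fourierCLM ν φ x * conj (fourierCLM ν φ x)‖ ∂(G j j).variation := by
    rw [← @inner_self_eq_norm_sq ℂ, L2.inner_def]
    have h2 : ∀ᵐ x ∂(G j j).variation,
        SchwartzMap.toLpCLM ℝ ℂ 2 (G j j).variation (fourierCLM ν φ) x = fourierCLM ν φ x :=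
      SchwartzMap.coeFn_toLp _ _ _
    have h3 : ∫ x, inner ℂ (SchwartzMap.toLpCLM ℝ ℂ 2 (G j j).variation (fourierCLM ν φ) x)
        (SchwartzMap.toLpCLM ℝ ℂ 2 (G j j).variation (fourierCLM ν φ) x) ∂(G j j).variation
        = ∫ x, ((‖fourierCLM ν φ x * conj (fourierCLM ν φ x)‖ : ℝ) : ℂ) ∂(G j j).variation := by
      refine integral_congr_ae ?_
      filter_upwards [h2] with x hx
      rw [hx, inner_self_eq_norm_sq_to_K]
      simp [sq]
    rw [h3, integral_complex_ofReal]
    rfl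
  rw [h1, (h.isDensity j j).variation_eq,
    ← integral_norm_mul_eq (h.isDensity j j).aestronglyMeasurable]
  exact (Complex.re_le_norm _).trans (norm_integral_le_integral_norm _)

end HasSpectralDensity

/-! ### Existence, stationarity and uniqueness in law of the field. -/

variable {μ : Measure (Space ν)} {g : Space ν → Matrix (Fin d) (Fin d) ℂ}

theorem IsMatrixSpectralMeasure.exists_density (h : IsMatrixSpectralMeasure G) :
    ∃ μ : Measure (Space ν), SigmaFinite μ ∧ ∃ g, HasSpectralDensity G μ g := by
  obtain ⟨-, μ, hμ, g, hg, hp⟩ := h.posSemidef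
  exact ⟨μ, hμ, g, hg, hp, h.moderate⟩

namespace HasSpectralDensity

theorem isStationary_of_hasSpectralRepresentation (h : HasSpectralDensity G μ g)
    {Ω : Type*} [MeasurableSpace Ω] {P : Measure Ω} {X : 𝓢(Space ν, ℝ) → Ω → (Fin d → ℝ)}
    (hm : ∀ φ, Measurable (X φ)) (hX : IsGaussianProcess X P)
    (h0 : ∀ φ j, ∫ ω, X φ ω j ∂P = 0)
    (hr : ∀ j j', HasSpectralRepresentation (G j j') (covFun P X j j')) : IsStationary P X := by
  refine fun t => identDistrib_of_covariance_eq hX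
    (hX.comp_right fun φ => SchwartzMap.compSubConstCLM ℝ t φ) hm (fun φ => hm _) h0
    (fun φ => h0 _) fun φ ψ j j' => ?_
  have h1 := h.spectralForm_eq_of_hasSpectralRepresentation (hr j j')
  have h2 := h1 (SchwartzMap.compSubConstCLM ℝ t φ) (SchwartzMap.compSubConstCLM ℝ t ψ)
  rw [spectralForm_shift, h1] at h2
  exact Complex.ofReal_injective h2

theorem exists_field (h : HasSpectralDensity G μ g) (he : ∀ j j', (G j j').IsEven) :
    ∃ (Ω : Type) (_ : MeasurableSpace Ω) (P : Measure Ω) (_ : IsProbabilityMeasure P)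
        (X : 𝓢(Space ν, ℝ) → Ω → (Fin d → ℝ)),
      IsCenteredGaussianStationaryField P X ∧
      ∀ j j', HasSpectralRepresentation (G j j') (covFun P X j j') := by
  obtain ⟨H, _, _, _, U, hU⟩ :=
    exists_hilbert_of_bilinForm h.covForm h.covForm_symm h.covForm_nonneg
  obtain ⟨Ω, _, P, _, W, hW⟩ := exists_isonormal H
  let U' : Fin d → 𝓢(Space ν, ℝ) →ₗ[ℝ] H := fun j =>
    U ∘ₗ LinearMap.single ℝ (fun _ : Fin d => 𝓢(Space ν, ℝ)) j
  have hU' : ∀ j j' φ ψ, inner ℝ (U' j φ) (U' j' ψ) = (spectralForm μ g j j' φ ψ).re :=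
    fun j j' φ ψ => (hU _ _).trans (h.covForm_single j j' φ ψ)
  let X : 𝓢(Space ν, ℝ) → Ω → (Fin d → ℝ) := fun φ ω j => W (U' j φ) ω
  have hmeas : ∀ φ, Measurable (X φ) := fun φ =>
    measurable_pi_lambda _ fun j => (Lp.stronglyMeasurable _).measurable
  have hgauss : IsGaussianProcess X P := by
    classical
    refine IsGaussianProcess.of_isGaussianProcess (isGaussianProcess_isonormal hW) fun φ =>
      ⟨Finset.univ.image fun j => U' j φ,
        { toFun := fun x j => x ⟨U' j φ, Finset.mem_image_of_mem _ (Finset.mem_univ j)⟩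
          map_add' := fun x y => rfl
          map_smul' := fun c x => rfl
          cont := by fun_prop }, fun ω => rfl⟩
  have hmean : ∀ φ j, ∫ ω, X φ ω j ∂P = 0 := fun φ j => integral_isonormal hW _
  have hrep : ∀ j j', HasSpectralRepresentation (G j j') (covFun P X j j') := fun j j' φ ψ => by
    have hc : covFun P X j j' φ ψ = (spectralForm μ g j j' φ ψ).re :=
      (integral_mul_isonormal W _ _).trans (hU' j j' φ ψ)
    rw [hc, h.ofReal_re_spectralForm (he j j')]
    exact h.hasIntegral j j' φ ψ
  refine ⟨Ω, inferInstance, P, inferInstance, X, ⟨⟨hmeas, fun a₁ a₂ φ ψ j => ?_,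
    fun φs φ hφ j => ?_⟩, hgauss, ?_, hmean⟩, hrep⟩
  · have e : W (U' j (a₁ • φ + a₂ • ψ)) = a₁ • W (U' j φ) + a₂ • W (U' j ψ) := by
      simp only [map_add, map_smul]
    filter_upwards [Lp.coeFn_add (a₁ • W (U' j φ)) (a₂ • W (U' j ψ)),
      Lp.coeFn_smul a₁ (W (U' j φ)), Lp.coeFn_smul a₂ (W (U' j ψ))] with ω e1 e2 e3
    simp only [X, e, e1, Pi.add_apply, e2, e3, Pi.smul_apply, smul_eq_mul]
  · have htg := h.moderate.hasTemperateGrowth j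
    -- L² convergence implies convergence in probability. Since `W` is an isometry, it is enough
    -- that φ ↦ U' j φ is continuous, which the bound by `S` ensures.
    refine tendstoInMeasure_of_tendsto_Lp ?_
    refine (W.continuous.tendsto _).comp ?_
    let S := SchwartzMap.toLpCLM ℝ ℂ 2 (G j j).variation ∘L fourierCLM ν
    have hle : ∀ ψ, ‖U' j ψ‖ ≤ ‖S ψ‖ := fun ψ => by
      refine abs_le_of_sq_le_sq' ?_ (norm_nonneg _) |>.2
      rw [← real_inner_self_eq_norm_sq, hU']
      exact h.re_spectralForm_self_le j ψ
    refine tendsto_iff_norm_sub_tendsto_zero.2 ?_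
    have hS := tendsto_iff_norm_sub_tendsto_zero.1 ((S.continuous.tendsto φ).comp hφ)
    refine squeeze_zero (fun _ => norm_nonneg _) (fun n => ?_) hS
    rw [← map_sub]
    refine (hle _).trans (le_of_eq ?_)
    rw [map_sub]
    rfl
  · exact h.isStationary_of_hasSpectralRepresentation hmeas hgauss hmean hrep

theorem identDistrib_of_hasSpectralRepresentation (h : HasSpectralDensity G μ g)
    {Ω₁ Ω₂ : Type*} [MeasurableSpace Ω₁] [MeasurableSpace Ω₂] {P₁ : Measure Ω₁} {P₂ : Measure Ω₂}
    {X₁ : 𝓢(Space ν, ℝ) → Ω₁ → (Fin d → ℝ)} {X₂ : 𝓢(Space ν, ℝ) → Ω₂ → (Fin d → ℝ)}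
    (h₁ : IsCenteredGaussianStationaryField P₁ X₁)
    (hr₁ : ∀ j j', HasSpectralRepresentation (G j j') (covFun P₁ X₁ j j'))
    (h₂ : IsCenteredGaussianStationaryField P₂ X₂)
    (hr₂ : ∀ j j', HasSpectralRepresentation (G j j') (covFun P₂ X₂ j j')) :
    IdentDistrib (fun ω φ => X₁ φ ω) (fun ω φ => X₂ φ ω) P₁ P₂ := by
  refine identDistrib_of_covariance_eq h₁.gaussian h₂.gaussian h₁.field.measurable
    h₂.field.measurable h₁.centered h₂.centered fun φ ψ j j' => ?_
  refine Complex.ofReal_injective ?_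
  exact (h.spectralForm_eq_of_hasSpectralRepresentation (hr₁ j j') φ ψ).symm.trans
    (h.spectralForm_eq_of_hasSpectralRepresentation (hr₂ j j') φ ψ)

/-! ### The covariance determines the spectral measure. -/

/-- Sesquilinear expansion: values of the form on real test functions determine it on all pairs of
complex Schwartz functions. -/
theorem integral_eq_spectralForm (h : HasSpectralDensity G μ g) (j j' : Fin d)
    {f k : 𝓢(Space ν, ℂ)} {φ₁ φ₂ ψ₁ ψ₂ : 𝓢(Space ν, ℝ)}
    (hf : ∀ x, f x = fourierCLM ν φ₁ x + Complex.I * fourierCLM ν φ₂ x)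
    (hk : ∀ x, k x = fourierCLM ν ψ₁ x + Complex.I * fourierCLM ν ψ₂ x) :
    ∫ x, f x * conj (k x) * g x j j' ∂μ
      = spectralForm μ g j j' φ₁ ψ₁ + -Complex.I * spectralForm μ g j j' φ₁ ψ₂
        + (Complex.I * spectralForm μ g j j' φ₂ ψ₁ + spectralForm μ g j j' φ₂ ψ₂) := by
  have hi := fun φ ψ => h.integrable j j' (fourierCLM ν φ) (fourierCLM ν ψ)
  simp_rw [spectralForm]
  rw [← integral_const_mul, ← integral_const_mul,
    ← integral_add (hi _ _) ((hi _ _).const_mul _),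
    ← integral_add ((hi _ _).const_mul _) (hi _ _)]
  refine Eq.trans (integral_congr_ae (ae_of_all _ fun x => ?_))
    (integral_add ((hi φ₁ ψ₁).add ((hi φ₁ ψ₂).const_mul (-Complex.I)))
      (((hi φ₂ ψ₁).const_mul Complex.I).add (hi φ₂ ψ₂)))
  simp only [hf, hk, map_add, map_mul, Complex.conj_I]
  linear_combination (-(fourierCLM ν φ₂ x * conj (fourierCLM ν ψ₂ x) * g x j j')) * Complex.I_sq

theorem integral_smooth_eq (h : HasSpectralDensity G μ g)
    {G' : Fin d → Fin d → LocComplexMeasure ν} {μ' : Measure (Space ν)}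
    {g' : Space ν → Matrix (Fin d) (Fin d) ℂ} (h' : HasSpectralDensity G' μ' g') {j j' : Fin d}
    (heq : ∀ φ ψ, spectralForm μ g j j' φ ψ = spectralForm μ' g' j j' φ ψ)
    {χ : Space ν → ℝ} (hχ : ContDiff ℝ (⊤ : ℕ∞) χ) (hc : HasCompactSupport χ) :
    ∫ x, χ x • g x j j' ∂μ = ∫ x, χ x • g' x j j' ∂μ' := by
  obtain ⟨R, hR⟩ := hc.isCompact.isBounded.subset_ball (0 : Space ν)
  -- The bump equals 1 on the support of `χ`, so `χ` is a product f conj(k) of the kind that the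
  -- form integrates. The maximum with 1 keeps the radius positive.
  let b : ContDiffBump (0 : Space ν) := ⟨max R 1, max R 1 + 1, by positivity, by simp⟩
  have toS : ∀ {f : Space ν → ℝ}, ContDiff ℝ (⊤ : ℕ∞) f → HasCompactSupport f →
      ∃ F : 𝓢(Space ν, ℂ), ∀ x, F x = f x := fun hf hc =>
    ⟨schwartzOfReal ν (hc.toSchwartzMap hf), fun x => rfl⟩
  obtain ⟨f, hf⟩ := toS hχ hc
  obtain ⟨k, hk⟩ := toS b.contDiff b.hasCompactSupport
  obtain ⟨φ₁, φ₂, hφ⟩ := exists_fourierCLM_add_I_mul f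
  obtain ⟨ψ₁, ψ₂, hψ⟩ := exists_fourierCLM_add_I_mul k
  have hfk : ∀ x, f x * conj (k x) = χ x := fun x => by
    rw [hf, hk, Complex.conj_ofReal]
    by_cases hx : χ x = 0
    · simp [hx]
    · have hxR : x ∈ Metric.ball (0 : Space ν) R := hR (subset_tsupport _ hx)
      rw [b.one_of_mem_closedBall]
      · simp
      · exact Metric.ball_subset_closedBall (Metric.ball_subset_ball (le_max_left _ _) hxR)
  have e1 := h.integral_eq_spectralForm j j' hφ hψ
  have e2 := h'.integral_eq_spectralForm j j' hφ hψ
  simp_rw [heq] at e1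
  simp_rw [hfk] at e1 e2
  simp_rw [Complex.real_smul]
  exact e1.trans e2.symm

end HasSpectralDensity

/-- Over the common dominating measure `μ + μ'` both measures have locally integrable densities.
Densities with equal integrals against smooth compactly supported functions agree almost everywhere.
-/
theorem LocComplexMeasure.eq_of_integral_smooth_eq {F F' : LocComplexMeasure ν}
    {μ μ' : Measure (Space ν)} [SigmaFinite μ] [SigmaFinite μ'] {f f' : Space ν → ℂ}
    (h : F.IsDensity μ f) (h' : F'.IsDensity μ' f')
    (heq : ∀ χ : Space ν → ℝ, ContDiff ℝ (⊤ : ℕ∞) χ → HasCompactSupport χ →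
      ∫ x, χ x • f x ∂μ = ∫ x, χ x • f' x ∂μ') : F = F' := by
  have hμ : μ ≪ μ + μ' := (Measure.le_add_right le_rfl).absolutelyContinuous
  have hμ' : μ' ≪ μ + μ' := (Measure.le_add_left le_rfl).absolutelyContinuous
  have d := h.of_absolutelyContinuous hμ
  have d' := h'.of_absolutelyContinuous hμ'
  have hae := ae_eq_of_integral_contDiff_smul_eq d.locallyIntegrable d'.locallyIntegrable
    fun χ hχ hc => by
      have e1 := integral_rnDeriv_smul (f := fun x => χ x • f x) hμ
      have e2 := integral_rnDeriv_smul (f := fun x => χ x • f' x) hμ'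
      simp_rw [smul_comm (χ _)]
      rw [e1, e2]
      exact heq χ hχ hc
  refine LocComplexMeasure.ext (funext fun A => ?_)
  rw [(d A).2, (d' A).2]
  exact integral_congr_ae (ae_restrict_of_ae hae)

end GenField

end

theorem theorem4p1 {ν d : ℕ} (G : Fin d → Fin d → LocComplexMeasure ν)
    (hG : IsMatrixSpectralMeasure G) :
    (∃ (Ω : Type) (_ : MeasurableSpace Ω) (P : Measure Ω) (_ : IsProbabilityMeasure P)
        (X : 𝓢(Space ν, ℝ) → Ω → (Fin d → ℝ)),
      IsCenteredGaussianStationaryField P X ∧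
      ∀ j j', HasSpectralRepresentation (G j j') (covFun P X j j')) ∧
    (∀ (Ω₁ : Type*) (_ : MeasurableSpace Ω₁) (P₁ : Measure Ω₁) (_ : IsProbabilityMeasure P₁)
        (X₁ : 𝓢(Space ν, ℝ) → Ω₁ → (Fin d → ℝ))
        (Ω₂ : Type*) (_ : MeasurableSpace Ω₂) (P₂ : Measure Ω₂) (_ : IsProbabilityMeasure P₂)
        (X₂ : 𝓢(Space ν, ℝ) → Ω₂ → (Fin d → ℝ)),
      IsCenteredGaussianStationaryField P₁ X₁ →
      (∀ j j', HasSpectralRepresentation (G j j') (covFun P₁ X₁ j j')) →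
      IsCenteredGaussianStationaryField P₂ X₂ →
      (∀ j j', HasSpectralRepresentation (G j j') (covFun P₂ X₂ j j')) →
      IdentDistrib (fun ω φ => X₁ φ ω) (fun ω φ => X₂ φ ω) P₁ P₂) ∧
    (∀ G' : Fin d → Fin d → LocComplexMeasure ν, IsMatrixSpectralMeasure G' →
      ∀ (j j' : Fin d) (r : 𝓢(Space ν, ℝ) → 𝓢(Space ν, ℝ) → ℝ),
        HasSpectralRepresentation (G j j') r → HasSpectralRepresentation (G' j j') r →
        G j j' = G' j j') := by
  obtain ⟨μ, _, g, h⟩ := hG.exists_density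
  refine ⟨h.exists_field hG.even, ?_, ?_⟩
  · intro Ω₁ _ P₁ _ X₁ Ω₂ _ P₂ _ X₂ h₁ hr₁ h₂ hr₂
    exact h.identDistrib_of_hasSpectralRepresentation h₁ hr₁ h₂ hr₂
  · intro G' hG' j j' r hr hr'
    obtain ⟨μ', _, g', h'⟩ := hG'.exists_density
    refine LocComplexMeasure.eq_of_integral_smooth_eq (h.isDensity j j') (h'.isDensity j j')
      fun χ hχ hc => h.integral_smooth_eq h' (fun φ ψ => ?_) hχ hc
    exact (h.spectralForm_eq_of_hasSpectralRepresentation hr φ ψ).trans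
      (h'.spectralForm_eq_of_hasSpectralRepresentation hr' φ ψ).symm
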